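/- **Notation.** Let $D$ be an ultrafilter over a set $I$. - For cardinals $\mu,\lambda$, $D$ is *$(\mu,\lambda)$-regular* if there is a function $f$ from $I$ to the family of subsets of $\lambda$ of cardinality $<\mu$ such that $\{i\in I : \alpha\in f(i)\}\in D$ for every $\alpha\in\lambda$. - $D$ is *$\lambda$-decomposable* if there is a partition of $I$ into $\lambda$ classes such that no union of fewer than $\lambda$ classes belongs to $D$. - $|\prod_D\lambda|$ is the cardinality of the ultrapower of $\lambda$ modulo $D$. - $\kappa^{+n}$ is the $n$-th cardinal successor of $\kappa$; $\beth_0(\lambda)=\lambda$ and $\beth_{m+1}(\lambda)=2^{\beth_m(\lambda)}$. **Theorem 4.3.** Let $D$ be an ultrafilter, $\kappa$ an infinite cardinal, $\nu$ a cardinal, and $n,m\ge 0$ integers. (a) If $|\prod_D \nu^{\kappa^{+n}}|>\nu^{\kappa^{+n}}$ (in particular, if $D$ is $(\nu^{\kappa^{+n}},\nu^{\kappa^{+n}})$-regular, since this implies the inequality), then $D$ is $\mu$-decomposable for some $\mu$ with $\kappa\le\mu\le\nu^{\kappa}$. If in addition $\nu^\kappa=\kappa^{+p}$ for some $p<\omega$,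 then $D$ is $(\kappa,\kappa)$-regular. (a$'$) If $m\ge1$ and $|\prod_D\beth_m(\kappa^{+n})|>\beth_m(\kappa^{+n})$ (in particular, if $D$ is $(\beth_m(\kappa^{+n}),\beth_m(\kappa^{+n}))$-regular, since this implies the inequality), then $D$ is $\mu$-decomposable for some $\mu$ with $\kappa\le\mu\le2^\kappa$. If in addition $2^\kappa=\kappa^{+p}$ for some $p<\omega$, then $D$ is $(\kappa,\kappa)$-regular. (b) Suppose that $\kappa$ is a strong limit cardinal ($\kappa=\omega$ allowed) and $|\prod_D\beth_m(\kappa^{+n})|>\beth_m(\kappa^{+n})$ (in particular, this holds if $D$ is $(\beth_m(\kappa^{+n}),\beth_m(\kappa^{+n}))$-regular). Then either $D$ is $(\operatorname{cf}\kappa,\operatorname{cf}\kappa)$-regular, or there are arbitrarily large $\mu<\kappa$ for which $D$ is $\mu$-decomposable, that is, for every $\mu'<\kappa$ there is $\mu$ with $\mu'<\mu<\kappa$ such that $D$ is $\mu$-decomposable. -/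

import Mathlib

open Cardinal

universe u

/-- The ultrafilter `D` over `I` is `(μ, lam)`-regular: there is a function from `I` to the
subsets of `lam` of cardinality `< μ` such that, for every `α ∈ lam`, the set
`{i ∈ I | α ∈ f i}` belongs to `D`. -/
def Ultrafilter.IsCardRegular {I : Type u} (D : Ultrafilter I) (μ lam : Cardinal.{u}) : Prop :=
  ∃ f : I → Set lam.out, (∀ i, #(f i) < μ) ∧ ∀ α : lam.out, {i | α ∈ f i} ∈ D

/-- The ultrafilter `D` over `I` is `lam`-decomposable: there is a partition of `I` (given as an
equivalence relation `r`, whose set of classes is `Quotient r`) into exactly `lam` classes such that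
the union of any family of fewer than `lam` classes does not belong to `D`. -/
def Ultrafilter.IsDecomposable {I : Type u} (D : Ultrafilter I) (lam : Cardinal.{u}) : Prop :=
  ∃ r : Setoid I, #(Quotient r) = lam ∧
    ∀ S : Set (Quotient r), #S < lam → {i | Quotient.mk r i ∈ S} ∉ D

/-- The cardinality `|∏_D c|` of the ultrapower of a set of cardinality `c` modulo `D`, that is of
the set of functions from `I` to `c` modulo equality on a set in `D`. -/
noncomputable def Ultrafilter.ultrapowerCard {I : Type u} (D : Ultrafilter I)
    (c : Cardinal.{u}) : Cardinal.{u} :=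
  #(Filter.Germ (D : Filter I) c.out)

/-- The `n`-th cardinal successor `κ^{+n}`. -/
noncomputable def Cardinal.iterSucc (n : ℕ) (κ : Cardinal.{u}) : Cardinal.{u} :=
  (Order.succ)^[n] κ

/-- The `m`-fold iterated exponential: `ℶ_0(κ) = κ` and `ℶ_{m+1}(κ) = 2 ^ ℶ_m(κ)`. -/
noncomputable def Cardinal.iterBeth (m : ℕ) (κ : Cardinal.{u}) : Cardinal.{u} :=
  (fun c : Cardinal.{u} => 2 ^ c)^[m] κ

/-!
# Decomposability of ultrafilters with large ultrapowers

Bounds for ultrapowers are derived from the absence of decompositions. The basic case is that of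
`ν ^ κ`. By Silver's argument (`exists_forall_factorsMod`), if `δ` is regular and `D` is not
decomposable for any cardinal in `[δ, 2 ^ δ]`, then some map `J` on `I` is finest, modulo `D`, among
the maps to `δ`. If there are no decompositions in `[δ, c]` with `2 ^ δ ≤ c`, then every map
from `I` to a set of size at most `c` takes fewer than `δ` values on a set in `D`; it is therefore
a function of `J`, which itself takes fewer than `δ` values, and the ultrapower of `c` has at most
`c ^ v` elements for some `v < δ` (`mk_germ_le_power`). Taking `c = ν ^ κ` bounds the ultrapower
of `ν ^ κ` when `κ` is regular. A singular `κ` reduces to a smaller regular cardinal: if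
decomposability were cofinal below `κ`, a joint map would give it in `[κ, 2 ^ κ]`
(`exists_isRegular_le_forall_not_isDecomposable`).

Three steps enlarge the exponent or the base.
* `λ⁺`-decomposability implies `(λ, λ)`-regularity (`isCardRegular_of_isDecomposable_succ`), so that
  decomposability at `κ^{+n}` descends to `κ⁺`, and to `(κ, κ)`-regularity.
* If `D` is not `λ⁺`-decomposable, then maps into `ν ^ λ⁺` are determined modulo `D` by their
  restrictions to the segments below `λ⁺` (`ultrapowerCard_power_succ_le`), and maps into `λ⁺` are
  bounded modulo `D` (`ultrapowerCard_le_of_bounded`); bounds pass from `ν ^ λ` to `ν ^ λ⁺`, and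
  from `λ` to `λ⁺`.
* The ultrapower of a power set embeds into the power set of the ultrapower
  (`ultrapowerCard_two_power_le`), so bounds pass from `c` to `2 ^ c`.

For a strong limit `κ` the starting point is the ultrapower of `κ` itself: if `D` is not
`cf κ`-decomposable, maps into `κ` are bounded modulo `D`, and if decomposability is also bounded
below `κ`, the ultrapowers of the cardinals below `κ` are small by the basic case. That the
regularity hypotheses imply large ultrapowers is a diagonal argument
(`lt_ultrapowerCard_of_isCardRegular`).

A function `f : I → κ.ord.ToType` is unbounded modulo `D` when `Tendsto f D atTop`.
-/

open Filter Order
open scoped Ordinal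

/-! ### Decomposability and regularity through functions -/

namespace Ultrafilter

variable {I : Type u} {D : Ultrafilter I}

/-- Among the images `f '' A` with `A ∈ D`, one of least cardinality yields a decomposition of
`D`: off `A` the value of `f` is replaced by some value taken on `A`. -/
theorem exists_isDecomposable_mk_image (D : Ultrafilter I) {X : Type u} (f : I → X) :
    ∃ A ∈ D, D.IsDecomposable #(f '' A) := by
  classical
  obtain ⟨⟨A, hA⟩, -, hmin⟩ := WellFounded.has_min
    (InvImage.wf (fun A : {A : Set I // A ∈ D} => #(f '' A.1)) Cardinal.lt_wf) Set.univ
    ⟨⟨Set.univ, univ_mem⟩, trivial⟩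
  have hmin' : ∀ B ∈ D, #(f '' A) ≤ #(f '' B) := fun B hB =>
    not_lt.1 (hmin ⟨B, hB⟩ trivial)
  obtain ⟨a₀, ha₀⟩ : A.Nonempty := D.nonempty_of_mem hA
  let g : I → f '' A := fun i => if h : i ∈ A then ⟨f i, i, h, rfl⟩ else ⟨f a₀, a₀, ha₀, rfl⟩
  have hg : ∀ i ∈ A, (g i : X) = f i := fun i hi => by simp [g, hi]
  have hsurj : Function.Surjective g := by
    rintro ⟨_, i, hi, rfl⟩
    exact ⟨i, Subtype.ext (hg i hi)⟩
  let e := Setoid.quotientKerEquivOfSurjective g hsurj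
  have he : ∀ i, e (Quotient.mk _ i) = g i := fun i => rfl
  refine ⟨A, hA, Setoid.ker g, Cardinal.mk_congr e, fun S hS hSD => ?_⟩
  have hB := inter_mem hSD hA
  refine (hmin' _ hB).not_gt (lt_of_le_of_lt ?_ hS)
  calc #(f '' ({i | Quotient.mk (Setoid.ker g) i ∈ S} ∩ A))
      ≤ #((fun q => (e q : X)) '' S) := by
        refine Cardinal.mk_le_mk_of_subset ?_
        rintro _ ⟨i, ⟨hiS, hiA⟩, rfl⟩
        exact ⟨_, hiS, by simp only [he, hg i hiA]⟩
    _ ≤ #S := Cardinal.mk_image_le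

/-- `D` is `#X`-decomposable iff some `f : I → X` has image of full size on every set in `D`. -/
theorem isDecomposable_mk_iff {X : Type u} :
    D.IsDecomposable #X ↔ ∃ f : I → X, ∀ A ∈ D, #X ≤ #(f '' A) := by
  constructor
  · rintro ⟨r, hr, h⟩
    obtain ⟨e⟩ := Cardinal.eq.1 hr
    refine ⟨fun i => e (Quotient.mk r i), fun A hA => ?_⟩
    by_contra! hlt
    refine h (Quotient.mk r '' A) ?_ (mem_of_superset hA fun i hi => ⟨i, hi, rfl⟩)
    rwa [← Cardinal.mk_image_eq (s := Quotient.mk r '' A) e.injective, Set.image_image]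
  · rintro ⟨f, hf⟩
    obtain ⟨A, hA, hdec⟩ := exists_isDecomposable_mk_image D f
    rwa [← le_antisymm (hf A hA) (Cardinal.mk_set_le _)] at hdec

theorem isCardRegular_mk_iff {X : Type u} {μ : Cardinal.{u}} :
    D.IsCardRegular μ #X ↔ ∃ f : I → Set X, (∀ i, #(f i) < μ) ∧ ∀ x, ∀ᶠ i in D, x ∈ f i := by
  have e : (#X).out ≃ X := Cardinal.outMkEquiv
  constructor
  · rintro ⟨f, hf, h⟩
    refine ⟨fun i => e '' f i, fun i => Cardinal.mk_image_le.trans_lt (hf i), fun x => ?_⟩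
    filter_upwards [h (e.symm x)] with i hi
    exact ⟨_, hi, e.apply_symm_apply x⟩
  · rintro ⟨f, hf, h⟩
    refine ⟨fun i => e.symm '' f i, fun i => Cardinal.mk_image_le.trans_lt (hf i), fun x => ?_⟩
    filter_upwards [h (e x)] with i hi
    exact ⟨_, hi, e.symm_apply_apply x⟩

theorem isCardRegular_ord_iff {μ lam : Cardinal.{u}} :
    D.IsCardRegular μ lam ↔ ∃ f : I → Set lam.ord.ToType,
      (∀ i, #(f i) < μ) ∧ ∀ x, ∀ᶠ i in D, x ∈ f i := by
  rw [← isCardRegular_mk_iff, Cardinal.mk_ord_toType]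

theorem IsCardRegular.mono {μ lam lam' : Cardinal.{u}} (h : D.IsCardRegular μ lam)
    (hle : lam' ≤ lam) : D.IsCardRegular μ lam' := by
  rw [← Cardinal.mk_out lam'] at hle ⊢
  rw [← Cardinal.mk_out lam] at h hle
  obtain ⟨j⟩ := hle
  obtain ⟨f, hf, hD⟩ := isCardRegular_mk_iff.1 h
  exact isCardRegular_mk_iff.2 ⟨fun i => j ⁻¹' f i,
    fun i => (Cardinal.mk_preimage_of_injective _ _ j.injective).trans_lt (hf i), fun x => hD _⟩

/-! ### Functions unbounded modulo the ultrafilter -/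

theorem exists_eventually_lt_of_not_tendsto_atTop {X : Type*} [LinearOrder X] {f : I → X}
    (h : ¬ Tendsto f D atTop) : ∃ b, ∀ᶠ i in D, f i < b := by
  rw [tendsto_atTop] at h
  push Not at h
  obtain ⟨b, hb⟩ := h
  exact ⟨b, hb⟩

theorem mk_Iio_ord_toType_lt {κ : Cardinal.{u}} (x : κ.ord.ToType) : #(Set.Iio x) < κ := by
  simpa using Cardinal.mk_Iio_lt x (by simp)

theorem mk_Iic_ord_toType_lt {κ : Cardinal.{u}} (hκ : ℵ₀ ≤ κ) (x : κ.ord.ToType) :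
    #(Set.Iic x) < κ := by
  rw [← Set.Iio_insert]
  refine Cardinal.mk_insert_le.trans_lt ?_
  exact Cardinal.add_lt_of_lt hκ (mk_Iio_ord_toType_lt x) (one_lt_aleph0.trans_le hκ)

theorem isCardRegular_of_tendsto_atTop {κ : Cardinal.{u}} (hκ : ℵ₀ ≤ κ) {f : I → κ.ord.ToType}
    (hf : Tendsto f D atTop) : D.IsCardRegular κ κ :=
  isCardRegular_ord_iff.2 ⟨fun i => Set.Iic (f i), fun _ => mk_Iic_ord_toType_lt hκ _,
    fun x => tendsto_atTop.1 hf x⟩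

theorem IsDecomposable.exists_tendsto_atTop {κ : Cardinal.{u}} (h : D.IsDecomposable κ) :
    ∃ f : I → κ.ord.ToType, Tendsto f D atTop := by
  rw [← Cardinal.mk_ord_toType κ] at h
  obtain ⟨f, hf⟩ := isDecomposable_mk_iff.1 h
  refine ⟨f, ?_⟩
  by_contra hlt
  obtain ⟨b, hb⟩ := exists_eventually_lt_of_not_tendsto_atTop hlt
  refine (hf _ hb).not_gt ?_
  rw [Cardinal.mk_ord_toType]
  refine lt_of_le_of_lt (Cardinal.mk_le_mk_of_subset ?_) (mk_Iio_ord_toType_lt b)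
  rintro _ ⟨i, hi, rfl⟩
  exact hi

theorem exists_forall_mem_lt {κ : Cardinal.{u}} (hκ : κ.IsRegular) {s : Set κ.ord.ToType}
    (hs : #s < κ) : ∃ b, ∀ y ∈ s, y < b := by
  rw [← not_isCofinal_iff]
  intro hc
  have := Order.cof_le hc
  rw [Ordinal.cof_toType, hκ.cof_ord] at this
  exact this.not_gt hs

theorem isDecomposable_of_tendsto_atTop {κ : Cardinal.{u}} (hκ : κ.IsRegular)
    {f : I → κ.ord.ToType} (hf : Tendsto f D atTop) : D.IsDecomposable κ := by
  rw [← Cardinal.mk_ord_toType κ]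
  refine isDecomposable_mk_iff.2 ⟨f, fun A hA => ?_⟩
  by_contra! hlt
  rw [Cardinal.mk_ord_toType] at hlt
  obtain ⟨b, hb⟩ := exists_forall_mem_lt hκ hlt
  obtain ⟨i, hi, hiA⟩ := D.nonempty_of_mem (inter_mem (tendsto_atTop.1 hf b) hA)
  exact (hb _ ⟨i, hiA, rfl⟩).not_ge hi

theorem isDecomposable_of_isCardRegular {κ : Cardinal.{u}} (hκ : κ.IsRegular)
    (h : D.IsCardRegular κ κ) : D.IsDecomposable κ := by
  obtain ⟨F, hF, hD⟩ := isCardRegular_ord_iff.1 h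
  choose s hs using fun i => exists_forall_mem_lt hκ (hF i)
  refine isDecomposable_of_tendsto_atTop hκ (f := s) (tendsto_atTop.2 fun b => ?_)
  filter_upwards [hD b] with i hi
  exact (hs i b hi).le

/-- A function unbounded in `κ` modulo `D` is turned into one unbounded in `cf κ`, by counting
how far along an enumeration of a cofinal set one has to go to exceed the given value. -/
theorem exists_tendsto_atTop_cof {κ : Cardinal.{u}} {f : I → κ.ord.ToType}
    (hf : Tendsto f D atTop) : ∃ g : I → κ.ord.cof.ord.ToType, Tendsto g D atTop := by
  obtain ⟨s, hs, hcard⟩ := Order.exists_cof_eq κ.ord.ToType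
  rw [Ordinal.cof_toType, ← Cardinal.mk_ord_toType κ.ord.cof] at hcard
  obtain ⟨e⟩ := Cardinal.eq.1 hcard.symm
  have hex : ∀ i, {y | f i ≤ e y}.Nonempty := fun i => by
    obtain ⟨c, hc, hle⟩ := hs (f i)
    exact ⟨e.symm ⟨c, hc⟩, by simpa using hle⟩
  let g : I → κ.ord.cof.ord.ToType := fun i => wellFounded_lt.min _ (hex i)
  have hg : ∀ i, f i ≤ e (g i) := fun i => wellFounded_lt.min_mem _ (hex i)
  refine ⟨g, tendsto_atTop.2 fun η => ?_⟩
  have hlt : #((fun y => (e y : κ.ord.ToType)) '' Set.Iio η) < κ.ord.cof :=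
    Cardinal.mk_image_le.trans_lt (mk_Iio_ord_toType_lt η)
  obtain ⟨b, hb⟩ : ∃ b, ∀ z ∈ (fun y => (e y : κ.ord.ToType)) '' Set.Iio η, z < b := by
    rw [← not_isCofinal_iff]
    intro hc
    have := Order.cof_le hc
    rw [Ordinal.cof_toType] at this
    exact this.not_gt hlt
  filter_upwards [tendsto_atTop.1 hf b] with i hi
  by_contra! hlt
  exact ((hg i).trans_lt (hb _ ⟨_, hlt, rfl⟩)).not_ge hi

theorem isDecomposable_cof_of_tendsto_atTop {κ : Cardinal.{u}} (hκ : ℵ₀ ≤ κ)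
    {f : I → κ.ord.ToType} (hf : Tendsto f D atTop) : D.IsDecomposable κ.ord.cof := by
  obtain ⟨g, hg⟩ := exists_tendsto_atTop_cof hf
  exact isDecomposable_of_tendsto_atTop (isRegular_cof (Cardinal.isSuccLimit_ord hκ)) hg

theorem IsDecomposable.isCardRegular {κ : Cardinal.{u}} (hκ : ℵ₀ ≤ κ) (h : D.IsDecomposable κ) :
    D.IsCardRegular κ κ := by
  obtain ⟨f, hf⟩ := h.exists_tendsto_atTop
  exact isCardRegular_of_tendsto_atTop hκ hf

/-! ### Descent from a successor cardinal -/

/-- If `D` is `λ⁺`-decomposable, then it is `(λ, λ)`-regular. Take `f : I → λ⁺` unbounded and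
injections `e x` of the segments below `x < λ⁺` into `λ`. Either some function
`i ↦ e (f i) β` is unbounded in `λ`, or all these functions are bounded, `λ` many of them by the
same `ξ < λ`. In the second case, as `e (f i)` is injective, each `i` belongs to fewer than `λ`
of the `λ` many sets `{i | β ≤ f i ∧ e (f i) β < ξ} ∈ D`. -/
theorem isCardRegular_of_isDecomposable_succ {lam : Cardinal.{u}} (hlam : ℵ₀ ≤ lam)
    (h : D.IsDecomposable (succ lam)) : D.IsCardRegular lam lam := by
  classical
  obtain ⟨f, hf⟩ := h.exists_tendsto_atTop
  have hne : Nonempty lam.ord.ToType :=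
    Cardinal.nonempty_ord_toType (aleph0_pos.trans_le hlam).ne'
  have hemb : ∀ x : (succ lam).ord.ToType, ∃ e : (succ lam).ord.ToType → lam.ord.ToType,
      Set.InjOn e (Set.Iic x) := fun x => by
    have : #(Set.Iic x) ≤ #lam.ord.ToType := by
      rw [Cardinal.mk_ord_toType]
      exact lt_succ_iff.1 (mk_Iic_ord_toType_lt (hlam.trans (le_succ _)) x)
    obtain ⟨e⟩ := this
    refine ⟨fun y => if hy : y ∈ Set.Iic x then e ⟨y, hy⟩ else hne.some, ?_⟩
    intro y hy z hz hyz
    simp only [hy, hz, dite_true] at hyz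
    exact congrArg Subtype.val (e.injective hyz)
  choose e he using hemb
  by_cases hall : ∃ β, Tendsto (fun i => e (f i) β) D atTop
  · obtain ⟨β, hβ⟩ := hall
    exact isCardRegular_of_tendsto_atTop hlam hβ
  push Not at hall
  choose ξ hξ using fun β => exists_eventually_lt_of_not_tendsto_atTop (hall β)
  obtain ⟨ζ, hζ⟩ : ∃ ζ, lam ≤ #(ξ ⁻¹' {ζ}) := by
    by_contra! hlt
    have h1 : #(succ lam).ord.ToType ≤ lam := by
      rw [← Cardinal.mk_congr (Equiv.sigmaFiberEquiv ξ), Cardinal.mk_sigma]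
      refine (Cardinal.sum_le_sum _ (fun _ => lam) fun ζ => (hlt ζ).le).trans ?_
      rw [Cardinal.sum_const', Cardinal.mk_ord_toType, Cardinal.mul_eq_self hlam]
    rw [Cardinal.mk_ord_toType] at h1
    exact h1.not_gt (lt_succ lam)
  obtain ⟨j⟩ : #lam.ord.ToType ≤ #(ξ ⁻¹' {ζ}) := by rwa [Cardinal.mk_ord_toType]
  refine isCardRegular_ord_iff.2
    ⟨fun i => {y | (j y : (succ lam).ord.ToType) ≤ f i ∧ e (f i) (j y) < ζ}, fun i => ?_,
      fun y => ?_⟩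
  · refine lt_of_le_of_lt ?_ (mk_Iio_ord_toType_lt ζ)
    refine Cardinal.mk_le_of_injective
      (f := fun y => (⟨e (f i) (j y.1), y.2.2⟩ : Set.Iio ζ)) fun y z hyz => ?_
    have := he (f i) y.2.1 z.2.1 (congrArg Subtype.val hyz)
    exact Subtype.ext (j.injective (Subtype.ext this))
  · filter_upwards [tendsto_atTop.1 hf (j y), hξ (j y)] with i h1 h2
    refine ⟨h1, ?_⟩
    have : ξ (j y) = ζ := (j y).2
    rwa [this] at h2

end Ultrafilter

namespace Cardinal

theorem iterSucc_succ (n : ℕ) (κ : Cardinal.{u}) : iterSucc (n + 1) κ = succ (iterSucc n κ) :=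
  Function.iterate_succ_apply' _ _ _

theorem le_iterSucc (n : ℕ) (κ : Cardinal.{u}) : κ ≤ iterSucc n κ := by
  induction n with
  | zero => exact le_rfl
  | succ n ih => exact ih.trans ((le_succ _).trans_eq (iterSucc_succ n κ).symm)

theorem iterBeth_succ (n : ℕ) (κ : Cardinal.{u}) : iterBeth (n + 1) κ = 2 ^ iterBeth n κ :=
  Function.iterate_succ_apply' _ _ _

/-- Every cardinal between `κ` and `κ^{+p}` is one of the iterated successors of `κ`. -/
theorem exists_eq_iterSucc {κ μ : Cardinal.{u}} (p : ℕ) (h1 : κ ≤ μ) (h2 : μ ≤ iterSucc p κ) :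
    ∃ q, μ = iterSucc q κ := by
  induction p with
  | zero => exact ⟨0, le_antisymm h2 h1⟩
  | succ p ih =>
    rcases h2.eq_or_lt with h | h
    · exact ⟨_, h⟩
    · rw [iterSucc_succ] at h
      exact ih (lt_succ_iff.1 h)

end Cardinal

namespace Ultrafilter

variable {I : Type u} {D : Ultrafilter I}

theorem isDecomposable_iterSucc_one {κ : Cardinal.{u}} (hκ : ℵ₀ ≤ κ) (n : ℕ)
    (h : D.IsDecomposable (iterSucc (n + 1) κ)) : D.IsDecomposable (succ κ) := by
  induction n with
  | zero => exact h
  | succ n ih =>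
    refine ih ?_
    have hn := hκ.trans (le_iterSucc n κ)
    rw [iterSucc_succ] at h
    have := isCardRegular_of_isDecomposable_succ (hκ.trans (le_iterSucc _ κ)) h
    rw [iterSucc_succ] at this ⊢
    exact isDecomposable_of_isCardRegular (isRegular_succ hn) this

theorem isCardRegular_of_isDecomposable_iterSucc {κ : Cardinal.{u}} (hκ : ℵ₀ ≤ κ) (n : ℕ)
    (h : D.IsDecomposable (iterSucc n κ)) : D.IsCardRegular κ κ := by
  cases n with
  | zero => exact h.isCardRegular hκ
  | succ n => exact isCardRegular_of_isDecomposable_succ hκ (isDecomposable_iterSucc_one hκ n h)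

end Ultrafilter

/-! ### The finest small partition -/

namespace Ultrafilter

variable {I : Type u} {D : Ultrafilter I}

theorem exists_mk_image_lt {δ c : Cardinal.{u}}
    (hno : ∀ μ, δ ≤ μ → μ ≤ c → ¬ D.IsDecomposable μ) {Y : Type u} (hY : #Y ≤ c) (f : I → Y) :
    ∃ A ∈ D, #(f '' A) < δ := by
  obtain ⟨A, hA, hdec⟩ := exists_isDecomposable_mk_image D f
  exact ⟨A, hA, not_le.1 fun h => hno _ h ((Cardinal.mk_set_le _).trans hY) hdec⟩

/-- `D.FactorsMod J h` says that `h` is, on a set belonging to `D`, a function of `J`; that is, the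
partition of `I` given by `J` refines the one given by `h`, modulo `D`. -/
def FactorsMod (D : Ultrafilter I) {Y Z : Type*} (J : I → Y) (h : I → Z) : Prop :=
  ∃ A ∈ D, ∀ i ∈ A, ∀ j ∈ A, J i = J j → h i = h j

/-- Silver's lemma: if `δ` is regular and `D` is not decomposable for any cardinal in `[δ, 2 ^ δ]`,
then, modulo `D`, some partition of `I` refines all partitions into at most `δ` classes.

Otherwise there are functions `h x`, for `x < δ`, such that `h x` does not factor through the
joint function `(h y)_{y < x}`. The joint function of all of them takes at most `2 ^ δ` values,
hence fewer than `δ` values on some `A ∈ D`. By regularity of `δ` these values are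
already told apart by `(h y)_{y < x}` for some `x < δ`, so that `h x` factors through it on `A`. -/
theorem exists_forall_factorsMod {δ : Cardinal.{u}} (hδ : δ.IsRegular)
    (hno : ∀ μ, δ ≤ μ → μ ≤ 2 ^ δ → ¬ D.IsDecomposable μ) :
    ∃ (Y : Type u) (J : I → Y), #Y ≤ 2 ^ δ ∧
      ∀ h : I → δ.ord.ToType, D.FactorsMod J h := by
  by_contra! hcon
  have hpow : δ ^ δ = 2 ^ δ := Cardinal.power_self_eq hδ.aleph0_le
  have hstep : ∀ (x : δ.ord.ToType) (G : ∀ y, y < x → I → δ.ord.ToType),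
      ∃ h : I → δ.ord.ToType, ¬ D.FactorsMod (fun i (y : Set.Iio x) => G y y.2 i) h := by
    intro x G
    refine hcon _ _ ?_
    rw [← Cardinal.power_def, Cardinal.mk_ord_toType, ← hpow]
    exact Cardinal.power_le_power_left hδ.ne_zero (mk_Iio_ord_toType_lt x).le
  choose N hN using hstep
  let h : δ.ord.ToType → I → δ.ord.ToType := wellFounded_lt.fix N
  have hh : ∀ x, h x = N x fun y _ => h y := fun x => wellFounded_lt.fix_eq N x
  obtain ⟨A, hA, hlt⟩ := exists_mk_image_lt hno
    (by rw [← Cardinal.power_def, Cardinal.mk_ord_toType, hpow]) fun i x => h x i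
  set V := (fun i x => h x i) '' A
  have hV : #((V ×ˢ V : Set _)) < δ := by
    rw [Cardinal.mk_setProd]
    exact Cardinal.mul_lt_of_lt hδ.aleph0_le (by simpa using hlt) (by simpa using hlt)
  -- a coordinate at which `p.1` and `p.2` differ, if there is one
  have hsep : ∀ p : (δ.ord.ToType → δ.ord.ToType) × (δ.ord.ToType → δ.ord.ToType),
      ∃ x, p.1 x = p.2 x → p.1 = p.2 := by
    intro p
    have : Nonempty δ.ord.ToType := Cardinal.nonempty_ord_toType hδ.ne_zero
    by_cases hp : p.1 = p.2
    · exact ⟨this.some, fun _ => hp⟩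
    · obtain ⟨x, hx⟩ := Function.ne_iff.1 hp
      exact ⟨x, fun h => (hx h).elim⟩
  choose d hd using hsep
  obtain ⟨b, hb⟩ := exists_forall_mem_lt hδ
    ((Cardinal.mk_image_le (f := d) (s := V ×ˢ V)).trans_lt hV)
  refine hN b (fun y _ => h y) ⟨A, hA, fun i hi j hj hij => ?_⟩
  rw [← hh b]
  have hmem : ((fun x => h x i, fun x => h x j) : _ × _) ∈ V ×ˢ V :=
    ⟨⟨i, hi, rfl⟩, ⟨j, hj, rfl⟩⟩
  have := hd (fun x => h x i, fun x => h x j) (congrFun hij ⟨_, hb _ ⟨_, hmem, rfl⟩⟩)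
  exact congrFun this b

/-! ### Bounds for the cardinality of ultrapowers -/

theorem mk_germ_le {Y : Type u} {Z : Type u} (F : (I → Y) → Z)
    (hF : ∀ h h', F h = F h' → h =ᶠ[D] h') : #(Germ (D : Filter I) Y) ≤ #Z := by
  refine Cardinal.mk_le_of_injective (f := fun x : Germ (D : Filter I) Y => F (Quotient.out x))
    fun x y hxy => ?_
  rw [← Quotient.out_eq x, ← Quotient.out_eq y]
  exact Quotient.sound (hF _ _ hxy)

theorem mk_germ_mono {X Y : Type u} (h : #X ≤ #Y) :
    #(Germ (D : Filter I) X) ≤ #(Germ (D : Filter I) Y) := by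
  obtain ⟨j⟩ := h
  refine mk_germ_le (fun f => ((j ∘ f : I → Y) : Germ (D : Filter I) Y)) fun f g hfg => ?_
  filter_upwards [Germ.coe_eq.1 hfg] with i hi
  exact j.injective hi

theorem ultrapowerCard_mk (D : Ultrafilter I) (X : Type u) :
    D.ultrapowerCard #X = #(Germ (D : Filter I) X) :=
  le_antisymm (mk_germ_mono (Cardinal.mk_out _).le) (mk_germ_mono (Cardinal.mk_out _).ge)

theorem ultrapowerCard_mono {c c' : Cardinal.{u}} (h : c ≤ c') :
    D.ultrapowerCard c ≤ D.ultrapowerCard c' :=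
  mk_germ_mono (by simpa using h)

theorem ultrapowerCard_le_self_of_lt_aleph0 {c : Cardinal.{u}} (hc : c < ℵ₀) :
    D.ultrapowerCard c ≤ c := by
  have : Finite c.out := Cardinal.lt_aleph0_iff_finite.1 (by simpa using hc)
  have hconst : ∀ f : I → c.out, ∃ x, ∀ᶠ i in D, f i = x := fun f => by
    simpa using D.eventually_exists_iff.1 (Eventually.of_forall fun i => ⟨f i, rfl⟩)
  choose x hx using hconst
  refine (mk_germ_le x fun f g hfg => ?_).trans_eq (Cardinal.mk_out c)
  filter_upwards [hx f, hx g] with i hf hg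
  rw [hf, hg, hfg]

/-- Diagonalization: a regular ultrafilter has a large ultrapower. -/
theorem lt_ultrapowerCard_of_isCardRegular {c : Cardinal.{u}} (h : D.IsCardRegular c c) :
    c < D.ultrapowerCard c := by
  obtain ⟨F, hF, hD⟩ := h
  by_contra! hle
  obtain ⟨j⟩ : #(Germ (D : Filter I) c.out) ≤ #c.out := by simpa [ultrapowerCard] using hle
  -- at `i`, avoid the values at `i` of the germs whose index lies in `F i`
  have hex : ∀ i, ∃ x : c.out, ∀ f : Germ (D : Filter I) c.out, j f ∈ F i →
      Quotient.out f i ≠ x := by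
    intro i
    by_contra! hall
    choose f hf hfx using hall
    have : #c.out ≤ #(F i) := by
      refine Cardinal.mk_le_of_injective (f := fun x => (⟨j (f x), hf x⟩ : F i)) fun x y hxy => ?_
      have := j.injective (congrArg Subtype.val hxy)
      rw [← hfx x, this, hfx y]
    rw [Cardinal.mk_out] at this
    exact this.not_gt (hF i)
  choose g hg using hex
  have h1 : Quotient.out ((g : I → c.out) : Germ (D : Filter I) c.out) =ᶠ[D] g :=
    Germ.coe_eq.1 (Quotient.out_eq (g : Germ (D : Filter I) c.out))
  obtain ⟨i, hi, hji⟩ := (h1.and (hD (j (g : Germ (D : Filter I) c.out)))).exists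
  exact hg i _ hji hi

/-- If the regular cardinal `δ` satisfies `2 ^ δ ≤ c` and `D` is not decomposable for any cardinal
in `[δ, c]`, then every function from `I` to a set of size at most `c` is, modulo `D`, a function
of a single map taking fewer than `δ` values; so the ultrapower is small. -/
theorem mk_germ_le_power {δ c : Cardinal.{u}} (hδ : δ.IsRegular) (hc : 2 ^ δ ≤ c)
    (hno : ∀ μ, δ ≤ μ → μ ≤ c → ¬ D.IsDecomposable μ) {Y : Type u} (hY : #Y ≤ c) :
    ∃ v < δ, #(Germ (D : Filter I) Y) ≤ #Y ^ v := by
  classical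
  have hX : Nonempty δ.ord.ToType := Cardinal.nonempty_ord_toType hδ.ne_zero
  obtain ⟨W, J, hW, hJ⟩ := exists_forall_factorsMod hδ fun μ h1 h2 => hno μ h1 (h2.trans hc)
  obtain ⟨A, hA, hlt⟩ := exists_mk_image_lt hno (hW.trans hc) J
  refine ⟨_, hlt, ?_⟩
  have hex : ∀ h : I → Y, ∃ g : J '' A → Y, ∃ B ∈ D, B ⊆ A ∧
      ∀ i, ∀ hi : i ∈ A, i ∈ B → h i = g ⟨J i, i, hi, rfl⟩ := by
    intro h
    obtain ⟨B, hB, hBlt⟩ := exists_mk_image_lt hno hY h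
    obtain ⟨e⟩ : #(h '' B) ≤ #δ.ord.ToType := by simpa using hBlt.le
    obtain ⟨C, hC, hfac⟩ := hJ fun i => if hi : i ∈ B then e ⟨h i, i, hi, rfl⟩ else hX.some
    have hYne : Nonempty Y := D.neBot.nonempty.map h
    have hmem : A ∩ (B ∩ C) ∈ D := inter_mem hA (inter_mem hB hC)
    refine ⟨fun w => if hw : ∃ i ∈ A ∩ (B ∩ C), J i = w then h hw.choose else hYne.some,
      _, hmem, Set.inter_subset_left, fun i hiA hi => ?_⟩
    have hw : ∃ k ∈ A ∩ (B ∩ C), J k = J i := ⟨i, hi, rfl⟩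
    obtain ⟨hk, hkJ⟩ := hw.choose_spec
    simp only [hw, dite_true]
    have := hfac i hi.2.2 _ hk.2.2 hkJ.symm
    simp only [hi.2.1, hk.2.1, dite_true] at this
    exact congrArg Subtype.val (e.injective this)
  choose g B hB hBA hg using hex
  refine (mk_germ_le g fun f f' hff' => ?_).trans_eq (by rw [Cardinal.power_def])
  filter_upwards [hB f, hB f'] with i hi hi'
  rw [hg f i (hBA f hi) hi, hg f' i (hBA f hi) hi', hff']

/-- The ultrapower of `2 ^ X` embeds into the power set of the ultrapower of `X`, by taking
a family of sets to the internal set it represents. -/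
theorem mk_germ_set_le (X : Type u) :
    #(Germ (D : Filter I) (Set X)) ≤ 2 ^ #(Germ (D : Filter I) X) := by
  rw [← Cardinal.mk_set]
  refine mk_germ_le
    (fun S => {x | ∃ g : I → X, x = (g : Germ (D : Filter I) X) ∧ ∀ᶠ i in D, g i ∈ S i})
    fun S T hST => ?_
  have key : ∀ S T : I → Set X,
      {x | ∃ g : I → X, x = (g : Germ (D : Filter I) X) ∧ ∀ᶠ i in D, g i ∈ S i} ⊆
        {x | ∃ g : I → X, x = (g : Germ (D : Filter I) X) ∧ ∀ᶠ i in D, g i ∈ T i} →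
      ∀ᶠ i in D, S i ⊆ T i := by
    intro S T hsub
    by_contra hnot
    have hev : ∀ᶠ i in D, ∃ x, x ∈ S i ∧ x ∉ T i := by
      filter_upwards [Ultrafilter.eventually_not.2 hnot] with i hi
      exact Set.not_subset.1 hi
    have hne : Nonempty X := let ⟨_, x, _⟩ := hev.exists; ⟨x⟩
    obtain ⟨g, hg⟩ := hev.choice
    obtain ⟨g', hgg', hg'⟩ := hsub ⟨g, rfl, hg.mono fun _ h => h.1⟩
    obtain ⟨i, ⟨h1, h2⟩, h3⟩ := ((hg.and hg').and (Germ.coe_eq.1 hgg')).exists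
    exact h1.2 (h3 ▸ h2)
  filter_upwards [key S T hST.le, key T S hST.ge] with i h1 h2
  exact h1.antisymm h2

theorem ultrapowerCard_two_power_le {c : Cardinal.{u}} (h : D.ultrapowerCard c ≤ c) :
    D.ultrapowerCard (2 ^ c) ≤ 2 ^ c := by
  have := mk_germ_set_le (D := D) c.out
  rw [← ultrapowerCard_mk, Cardinal.mk_set, Cardinal.mk_out] at this
  exact this.trans (Cardinal.power_le_power_left two_ne_zero h)

theorem ultrapowerCard_iterBeth_le {c : Cardinal.{u}} (h : D.ultrapowerCard c ≤ c) (m : ℕ) :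
    D.ultrapowerCard (iterBeth m c) ≤ iterBeth m c := by
  induction m with
  | zero => exact h
  | succ m ih =>
    rw [iterBeth_succ]
    exact ultrapowerCard_two_power_le ih

/-- If `D` is not `λ⁺`-decomposable, then functions from `I` to the power `ν ^ λ⁺` are determined,
modulo `D`, by their restrictions to the proper initial segments of `λ⁺`: the least
difference of two functions would be unbounded in `λ⁺`. -/
theorem ultrapowerCard_power_succ_le {lam ν : Cardinal.{u}} (hlam : ℵ₀ ≤ lam) (hν : ν ≠ 0)
    (hno : ¬ D.IsDecomposable (succ lam)) (h : D.ultrapowerCard (ν ^ lam) ≤ ν ^ lam) :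
    D.ultrapowerCard (ν ^ succ lam) ≤ ν ^ succ lam := by
  have hpow : #((succ lam).ord.ToType → ν.out) = ν ^ succ lam := by
    rw [← Cardinal.power_def, Cardinal.mk_out, Cardinal.mk_ord_toType]
  rw [← hpow, ultrapowerCard_mk, hpow]
  have hle : #(Germ (D : Filter I) ((succ lam).ord.ToType → ν.out)) ≤
      #(∀ β : (succ lam).ord.ToType, Germ (D : Filter I) (Set.Iio β → ν.out)) := by
    refine mk_germ_le (fun f β => ((fun i (y : Set.Iio β) => f i y : I → Set.Iio β → ν.out) :
      Germ (D : Filter I) (Set.Iio β → ν.out))) fun f g hfg => ?_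
    by_contra hne
    have hne' : ∀ᶠ i in D, ∃ y, f i y ≠ g i y := by
      filter_upwards [Ultrafilter.eventually_not.2 hne] with i hi
      exact Function.ne_iff.1 hi
    have hXne : Nonempty (succ lam).ord.ToType := let ⟨_, x, _⟩ := hne'.exists; ⟨x⟩
    have hmin : ∀ᶠ i in D, ∃ y, f i y ≠ g i y ∧ ∀ z < y, f i z = g i z := by
      filter_upwards [hne'] with i hi
      refine ⟨wellFounded_lt.min _ hi, wellFounded_lt.min_mem _ hi, fun z hz => ?_⟩
      by_contra hzne
      exact wellFounded_lt.not_lt_min _ hzne hz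
    obtain ⟨s, hs⟩ := hmin.choice
    refine hno (isDecomposable_of_tendsto_atTop (isRegular_succ hlam) (f := s)
      (tendsto_atTop.2 fun b => ?_))
    filter_upwards [hs, Germ.coe_eq.1 (congrFun hfg b)] with i hi hib
    by_contra! hlt
    exact hi.1 (congrFun hib ⟨s i, hlt⟩)
  refine hle.trans ?_
  rw [Cardinal.mk_pi]
  refine (Cardinal.prod_le_prod _ (fun _ => ν ^ lam) fun β => ?_).trans ?_
  · refine (mk_germ_mono (Y := (ν ^ lam).out) ?_).trans h
    rw [← Cardinal.power_def, Cardinal.mk_out, Cardinal.mk_out]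
    exact Cardinal.power_le_power_left hν (lt_succ_iff.1 (mk_Iio_ord_toType_lt β))
  · rw [Cardinal.prod_const', Cardinal.mk_ord_toType, ← Cardinal.power_mul,
      Cardinal.mul_eq_right (hlam.trans (le_succ _)) (le_succ _) (aleph0_pos.trans_le hlam).ne']

/-- If all functions from `I` to `κ` are bounded modulo `D`, the ultrapower of `κ` is the union of
the ultrapowers of the smaller cardinals. -/
theorem ultrapowerCard_le_of_bounded {κ : Cardinal.{u}} (hκ : ℵ₀ ≤ κ)
    (hbdd : ∀ f : I → κ.ord.ToType, ¬ Tendsto f D atTop)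
    (h : ∀ c < κ, D.ultrapowerCard c ≤ κ) : D.ultrapowerCard κ ≤ κ := by
  have hex : ∀ f : I → κ.ord.ToType, ∃ p : Σ β : κ.ord.ToType, I → Set.Iio β,
      ∀ᶠ i in D, f i = p.2 i := fun f => by
    obtain ⟨b, hb⟩ := exists_eventually_lt_of_not_tendsto_atTop (hbdd f)
    have : Nonempty (Set.Iio b) := let ⟨i, hi⟩ := hb.exists; ⟨⟨f i, hi⟩⟩
    have hb' : ∀ᶠ i in D, ∃ y : Set.Iio b, f i = y := hb.mono fun i hi => ⟨⟨f i, hi⟩, rfl⟩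
    obtain ⟨g, hg⟩ := hb'.choice
    exact ⟨⟨b, g⟩, hg⟩
  choose p hp using hex
  have hle : #(Germ (D : Filter I) κ.ord.ToType) ≤
      #(Σ β : κ.ord.ToType, Germ (D : Filter I) (Set.Iio β)) := by
    refine mk_germ_le (fun f => ⟨(p f).1, ((p f).2 : Germ (D : Filter I) _)⟩) fun f g hfg => ?_
    have h1 := hp f
    have h2 := hp g
    generalize p f = P at *
    generalize p g = Q at *
    obtain ⟨β, P⟩ := P
    obtain ⟨γ, Q⟩ := Q
    obtain ⟨rfl, hPQ⟩ := Sigma.mk.inj_iff.1 hfg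
    filter_upwards [h1, h2, Germ.coe_eq.1 (eq_of_heq hPQ)] with i h1 h2 h3
    rw [h1, h2]
    exact congrArg Subtype.val h3
  rw [← Cardinal.mk_ord_toType κ, ultrapowerCard_mk, Cardinal.mk_ord_toType κ]
  refine hle.trans ?_
  rw [Cardinal.mk_sigma]
  refine (Cardinal.sum_le_sum _ (fun _ => κ) fun β => ?_).trans ?_
  · rw [← ultrapowerCard_mk]
    exact h _ (mk_Iio_ord_toType_lt β)
  · rw [Cardinal.sum_const', Cardinal.mk_ord_toType, Cardinal.mul_eq_self hκ]

theorem ultrapowerCard_iterSucc_le {κ : Cardinal.{u}} (hκ : ℵ₀ ≤ κ)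
    (hreg : ¬ D.IsCardRegular κ κ) (h : D.ultrapowerCard κ ≤ κ) (n : ℕ) :
    D.ultrapowerCard (iterSucc n κ) ≤ iterSucc n κ := by
  induction n with
  | zero => exact h
  | succ n ih =>
    have hn : ℵ₀ ≤ iterSucc n κ := hκ.trans (le_iterSucc n κ)
    have hno : ¬ D.IsDecomposable (iterSucc (n + 1) κ) := fun hd =>
      hreg (isCardRegular_of_isDecomposable_iterSucc hκ _ hd)
    rw [iterSucc_succ] at hno ⊢
    refine ultrapowerCard_le_of_bounded (hn.trans (le_succ _))
      (fun f hf => hno (isDecomposable_of_tendsto_atTop (isRegular_succ hn) hf)) fun c hc => ?_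
    exact (ultrapowerCard_mono (lt_succ_iff.1 hc)).trans (ih.trans (le_succ _))

end Ultrafilter

/-! ### Ultrapowers of powers and of strong limit cardinals -/

namespace Ultrafilter

variable {I : Type u} {D : Ultrafilter I}

theorem exists_mk_Iio_eq {κ c : Cardinal.{u}} (hc : c < κ) :
    ∃ x : κ.ord.ToType, #(Set.Iio x) = c := by
  have hlt : c.ord < typeLT κ.ord.ToType := by simpa using Cardinal.ord_lt_ord.2 hc
  obtain ⟨x, hx⟩ := Ordinal.typein_surj (α := κ.ord.ToType) LT.lt hlt
  exact ⟨x, (Ordinal.card_typein (r := LT.lt) x).symm.trans (by rw [hx, Cardinal.card_ord])⟩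

/-- If `D` is decomposable for cofinally many cardinals below the singular cardinal `κ`,
the corresponding maps combine to one with at most `2 ^ κ` values and at least `κ` values on each
set in `D`; hence an interval `[κ, c]` free of decomposability extends down to a regular
cardinal. -/
theorem exists_isRegular_le_forall_not_isDecomposable {κ c : Cardinal.{u}} (hκ : ℵ₀ ≤ κ)
    (hc : 2 ^ κ ≤ c) (hno : ∀ μ, κ ≤ μ → μ ≤ c → ¬ D.IsDecomposable μ) :
    ∃ δ ≤ κ, δ.IsRegular ∧ ∀ μ, δ ≤ μ → μ ≤ c → ¬ D.IsDecomposable μ := by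
  by_contra! hcon
  rcases isRegular_or_isSingular hκ with hreg | hsing
  · obtain ⟨μ, h1, h2, h3⟩ := hcon κ le_rfl hreg
    exact hno μ h1 h2 h3
  have hcof : ∀ x : κ.ord.ToType, ∃ f : I → κ.ord.ToType, ∀ A ∈ D, #(Set.Iio x) ≤ #(f '' A) := by
    intro x
    have hlt : max ℵ₀ #(Set.Iio x) < κ :=
      max_lt (hκ.lt_of_ne fun h => not_isSingular_aleph0 (h ▸ hsing)) (mk_Iio_ord_toType_lt x)
    obtain ⟨μ, h1, h2, h3⟩ := hcon (succ (max ℵ₀ #(Set.Iio x))) (succ_le_of_lt hlt)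
      (isRegular_succ (le_max_left _ _))
    have hμ : μ < κ := not_le.1 fun h => hno μ h h2 h3
    rw [← Cardinal.mk_out μ] at h3
    obtain ⟨f, hf⟩ := isDecomposable_mk_iff.1 h3
    obtain ⟨e⟩ : #μ.out ≤ #κ.ord.ToType := by simpa using hμ.le
    refine ⟨fun i => e (f i), fun A hA => ?_⟩
    rw [← Set.image_image (fun y => e y) f A, Cardinal.mk_image_eq e.injective]
    refine le_trans ?_ (hf A hA)
    rw [Cardinal.mk_out]
    exact (le_max_right _ _).trans ((le_succ _).trans h1)
  choose f hf using hcof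
  have hcard : #(κ.ord.ToType → κ.ord.ToType) ≤ c := by
    rw [← Cardinal.power_def, Cardinal.mk_ord_toType, Cardinal.power_self_eq hκ]
    exact hc
  obtain ⟨A, hA, hdec⟩ := exists_isDecomposable_mk_image D fun i x => f x i
  refine hno _ ?_ ((Cardinal.mk_set_le _).trans hcard) hdec
  by_contra! hlt
  obtain ⟨x, hx⟩ := exists_mk_Iio_eq (hsing.isSuccLimit.succ_lt hlt)
  have h1 := hf x A hA
  rw [hx] at h1
  refine (lt_succ _).not_ge (h1.trans ?_)
  refine (Cardinal.mk_le_mk_of_subset ?_).trans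
    (Cardinal.mk_image_le (f := fun g : κ.ord.ToType → κ.ord.ToType => g x))
  rintro _ ⟨i, hi, rfl⟩
  exact ⟨_, ⟨i, hi, rfl⟩, rfl⟩

theorem ultrapowerCard_power_le {κ ν : Cardinal.{u}} (hκ : ℵ₀ ≤ κ) (hν : 2 ≤ ν)
    (hno : ∀ μ, κ ≤ μ → μ ≤ ν ^ κ → ¬ D.IsDecomposable μ) :
    D.ultrapowerCard (ν ^ κ) ≤ ν ^ κ := by
  have h2 : 2 ^ κ ≤ ν ^ κ := Cardinal.power_le_power_right hν
  obtain ⟨δ, hδκ, hδ, hno'⟩ := exists_isRegular_le_forall_not_isDecomposable hκ h2 hno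
  obtain ⟨v, hv, hle⟩ := mk_germ_le_power hδ
    ((Cardinal.power_le_power_left two_ne_zero hδκ).trans h2) hno' (Cardinal.mk_out (ν ^ κ)).le
  refine hle.trans ?_
  rw [Cardinal.mk_out, ← Cardinal.power_mul]
  refine Cardinal.power_le_power_left (two_pos.trans_le hν).ne' ?_
  exact (mul_le_mul_right (hv.le.trans hδκ) κ).trans_eq (Cardinal.mul_eq_self hκ)

theorem ultrapowerCard_power_iterSucc_le {κ ν : Cardinal.{u}} (hκ : ℵ₀ ≤ κ)
    (hno : ∀ μ, κ ≤ μ → μ ≤ ν ^ κ → ¬ D.IsDecomposable μ) (n : ℕ) :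
    D.ultrapowerCard (ν ^ iterSucc n κ) ≤ ν ^ iterSucc n κ := by
  rcases lt_or_ge ν 2 with hν | hν
  · have hν1 : ν ≤ 1 := by
      obtain ⟨k, rfl⟩ := Cardinal.lt_aleph0.1 (hν.trans (Cardinal.natCast_lt_aleph0 (n := 2)))
      norm_cast at hν ⊢
      omega
    refine ultrapowerCard_le_self_of_lt_aleph0 (lt_of_le_of_lt ?_ one_lt_aleph0)
    exact (Cardinal.power_le_power_right hν1).trans_eq Cardinal.one_power
  have hsucc : ¬ D.IsDecomposable (succ κ) := hno _ (le_succ κ)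
    (succ_le_of_lt ((cantor κ).trans_le (Cardinal.power_le_power_right hν)))
  induction n with
  | zero => exact ultrapowerCard_power_le hκ hν hno
  | succ n ih =>
    have hn : ¬ D.IsDecomposable (iterSucc (n + 1) κ) := fun hd =>
      hsucc (isDecomposable_iterSucc_one hκ n hd)
    rw [iterSucc_succ] at hn ⊢
    exact ultrapowerCard_power_succ_le (hκ.trans (le_iterSucc n κ)) (two_pos.trans_le hν).ne' hn ih

theorem exists_isDecomposable_of_lt_ultrapowerCard_power {κ ν : Cardinal.{u}} (hκ : ℵ₀ ≤ κ) (n : ℕ)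
    (h : ν ^ iterSucc n κ < D.ultrapowerCard (ν ^ iterSucc n κ)) :
    (∃ μ, κ ≤ μ ∧ μ ≤ ν ^ κ ∧ D.IsDecomposable μ) ∧
      ((∃ p : ℕ, ν ^ κ = iterSucc p κ) → D.IsCardRegular κ κ) := by
  have hex : ∃ μ, κ ≤ μ ∧ μ ≤ ν ^ κ ∧ D.IsDecomposable μ := by
    by_contra! hno
    exact h.not_ge (ultrapowerCard_power_iterSucc_le hκ hno n)
  refine ⟨hex, ?_⟩
  rintro ⟨p, hp⟩
  obtain ⟨μ, h1, h2, hd⟩ := hex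
  obtain ⟨q, rfl⟩ := exists_eq_iterSucc p h1 (h2.trans_eq hp)
  exact isCardRegular_of_isDecomposable_iterSucc hκ q hd

/-- If `D` is not `cf κ`-decomposable, the sizes of the sets witnessing `(κ, κ)`-regularity are
bounded by some `θ < κ` on a set in `D`. -/
theorem IsCardRegular.exists_lt {κ : Cardinal.{u}} (hκ : ℵ₀ ≤ κ) (h : D.IsCardRegular κ κ)
    (hcof : ¬ D.IsDecomposable κ.ord.cof) : ∃ θ < κ, D.IsCardRegular (succ θ) κ := by
  obtain ⟨F, hF, hD⟩ := h
  choose s hs using fun i => exists_mk_Iio_eq (hF i)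
  obtain ⟨b, hb⟩ := exists_eventually_lt_of_not_tendsto_atTop (f := s)
    fun hs => hcof (isDecomposable_cof_of_tendsto_atTop hκ hs)
  refine ⟨#(Set.Iio b), mk_Iio_ord_toType_lt b,
    fun i => {α | α ∈ F i ∧ s i < b}, fun i => lt_succ_iff.2 ?_, fun α => ?_⟩
  · by_cases hi : s i < b
    · refine (Cardinal.mk_le_mk_of_subset (t := F i) fun α h => h.1).trans ?_
      rw [← hs i]
      exact Cardinal.mk_le_mk_of_subset (Set.Iio_subset_Iio hi.le)
    · simp [hi]
  · filter_upwards [hD α, hb] with i h1 h2 using ⟨h1, h2⟩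

theorem exists_isDecomposable_lt_of_isCardRegular {κ : Cardinal.{u}} (hκ : κ.IsStrongLimit)
    (h : D.IsCardRegular κ κ) (hcof : ¬ D.IsDecomposable κ.ord.cof) {μ' : Cardinal.{u}}
    (hμ' : μ' < κ) : ∃ μ, μ' < μ ∧ μ < κ ∧ D.IsDecomposable μ := by
  have hκ' := hκ.aleph0_le
  have hlim := hκ.isSuccLimit
  have hsing : κ.IsSingular := IsSingular.of_not_isRegular hκ' fun hreg => by
    rw [hreg.cof_ord] at hcof
    exact hcof (isDecomposable_of_isCardRegular hreg h)
  obtain ⟨θ, hθ, hreg⟩ := h.exists_lt hκ' hcof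
  have hω : ℵ₀ < κ := hκ'.lt_of_ne fun h => not_isSingular_aleph0 (h ▸ hsing)
  have hlt : max ℵ₀ (max μ' θ) < κ := max_lt hω (max_lt hμ' hθ)
  have hτ : succ (max ℵ₀ (max μ' θ)) < κ := hlim.succ_lt hlt
  have hθτ : succ θ ≤ succ (max ℵ₀ (max μ' θ)) :=
    succ_le_succ ((le_max_right _ _).trans (le_max_right _ _))
  obtain ⟨F, hF, hD⟩ := hreg.mono hτ.le
  exact ⟨_, lt_succ_iff.2 ((le_max_left _ _).trans (le_max_right _ _)), hτ,
    isDecomposable_of_isCardRegular (isRegular_succ (le_max_left _ _))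
      ⟨F, fun i => (hF i).trans_le hθτ, hD⟩⟩

theorem ultrapowerCard_le_of_isStrongLimit {κ : Cardinal.{u}} (hκ : κ.IsStrongLimit)
    (hcof : ¬ D.IsDecomposable κ.ord.cof) {μ' : Cardinal.{u}} (hμ' : μ' < κ)
    (hno : ∀ μ, μ' < μ → μ < κ → ¬ D.IsDecomposable μ) : D.ultrapowerCard κ ≤ κ := by
  have hκ' := hκ.aleph0_le
  have hlim := hκ.isSuccLimit
  refine ultrapowerCard_le_of_bounded hκ'
    (fun f hf => hcof (isDecomposable_cof_of_tendsto_atTop hκ' hf)) fun c hc => ?_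
  rcases lt_or_ge c ℵ₀ with hfin | hinf
  · exact (ultrapowerCard_le_self_of_lt_aleph0 hfin).trans hc.le
  have hδ : succ (max c μ') < κ := hlim.succ_lt (max_lt hc hμ')
  have hpow : ∀ x < κ, (2 : Cardinal.{u}) ^ x < κ := fun x hx => hκ.isStrongPrelimit hx
  obtain ⟨v, hv, hle⟩ := mk_germ_le_power (D := D) (Y := c.out)
    (isRegular_succ (hinf.trans (le_max_left c μ'))) le_rfl
    (fun μ h1 h2 => hno μ ((le_max_right _ _).trans_lt (succ_le_iff.1 h1))
      (h2.trans_lt (hpow _ hδ)))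
    (by
      rw [Cardinal.mk_out]
      exact (le_max_left _ _).trans ((le_succ _).trans (cantor _).le))
  refine hle.trans ?_
  rw [Cardinal.mk_out]
  refine le_of_lt (lt_of_le_of_lt ?_ (hpow _ hδ))
  have hcδ : c ≤ succ (max c μ') := (le_max_left _ _).trans (le_succ _)
  rw [← Cardinal.power_self_eq (hinf.trans hcδ)]
  exact (Cardinal.power_le_power_right hcδ).trans
    (Cardinal.power_le_power_left (aleph0_pos.trans_le (hinf.trans hcδ)).ne' hv.le)

end Ultrafilter

open Ultrafilter in
theorem theorem4p3 {I : Type u} (D : Ultrafilter I) (κ : Cardinal.{u}) (hκ : ℵ₀ ≤ κ) :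
    -- (a)
    (∀ (ν : Cardinal.{u}) (n : ℕ),
      (D.IsCardRegular (ν ^ Cardinal.iterSucc n κ) (ν ^ Cardinal.iterSucc n κ) →
        ν ^ Cardinal.iterSucc n κ < D.ultrapowerCard (ν ^ Cardinal.iterSucc n κ)) ∧
      (ν ^ Cardinal.iterSucc n κ < D.ultrapowerCard (ν ^ Cardinal.iterSucc n κ) →
        (∃ μ : Cardinal.{u}, κ ≤ μ ∧ μ ≤ ν ^ κ ∧ D.IsDecomposable μ) ∧
        ((∃ p : ℕ, ν ^ κ = Cardinal.iterSucc p κ) → D.IsCardRegular κ κ))) ∧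
    -- (a')
    (∀ m n : ℕ, 1 ≤ m →
      (D.IsCardRegular (Cardinal.iterBeth m (Cardinal.iterSucc n κ))
          (Cardinal.iterBeth m (Cardinal.iterSucc n κ)) →
        Cardinal.iterBeth m (Cardinal.iterSucc n κ) <
          D.ultrapowerCard (Cardinal.iterBeth m (Cardinal.iterSucc n κ))) ∧
      (Cardinal.iterBeth m (Cardinal.iterSucc n κ) <
          D.ultrapowerCard (Cardinal.iterBeth m (Cardinal.iterSucc n κ)) →
        (∃ μ : Cardinal.{u}, κ ≤ μ ∧ μ ≤ 2 ^ κ ∧ D.IsDecomposable μ) ∧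
        ((∃ p : ℕ, (2 : Cardinal.{u}) ^ κ = Cardinal.iterSucc p κ) → D.IsCardRegular κ κ))) ∧
    -- (b)
    (Cardinal.IsStrongLimit κ → ∀ m n : ℕ,
      (D.IsCardRegular (Cardinal.iterBeth m (Cardinal.iterSucc n κ))
          (Cardinal.iterBeth m (Cardinal.iterSucc n κ)) →
        Cardinal.iterBeth m (Cardinal.iterSucc n κ) <
          D.ultrapowerCard (Cardinal.iterBeth m (Cardinal.iterSucc n κ))) ∧
      (Cardinal.iterBeth m (Cardinal.iterSucc n κ) <
          D.ultrapowerCard (Cardinal.iterBeth m (Cardinal.iterSucc n κ)) →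
        D.IsCardRegular κ.ord.cof κ.ord.cof ∨
        ∀ μ' : Cardinal.{u}, μ' < κ →
          ∃ μ : Cardinal.{u}, μ' < μ ∧ μ < κ ∧ D.IsDecomposable μ)) := by
  refine ⟨fun ν n => ⟨lt_ultrapowerCard_of_isCardRegular,
      exists_isDecomposable_of_lt_ultrapowerCard_power hκ n⟩,
    fun m n hm => ⟨lt_ultrapowerCard_of_isCardRegular, fun h =>
      exists_isDecomposable_of_lt_ultrapowerCard_power hκ n ?_⟩,
    fun hlim m n => ⟨lt_ultrapowerCard_of_isCardRegular, fun h => ?_⟩⟩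
  · obtain ⟨m, rfl⟩ := Nat.exists_eq_add_of_le' hm
    by_contra! hle
    -- `ℶ_{m+1}(c) = ℶ_m(2 ^ c)`
    exact h.not_ge (ultrapowerCard_iterBeth_le hle m)
  · by_contra! hcon
    obtain ⟨hcof, μ', hμ', hno⟩ := hcon
    have hcof' : ¬ D.IsDecomposable κ.ord.cof := fun hd =>
      hcof (hd.isCardRegular (isRegular_cof (Cardinal.isSuccLimit_ord hκ)).aleph0_le)
    have hreg : ¬ D.IsCardRegular κ κ := fun hr => by
      obtain ⟨μ, h1, h2, h3⟩ := exists_isDecomposable_lt_of_isCardRegular hlim hr hcof' hμ'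
      exact hno μ h1 h2 h3
    exact h.not_ge (ultrapowerCard_iterBeth_le (ultrapowerCard_iterSucc_le hκ hreg
      (ultrapowerCard_le_of_isStrongLimit hlim hcof' hμ' hno) n) m)
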